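/- Let $\mathbb D$ denote the open unit disc in $\mathbb C$. Let $N$ be a positive integer or $N=\infty$, let $\mu_1,\mu_2,\dots$ be a sequence of points of $\mathbb D$ (not necessarily distinct), let $p=\prod_{j=1}^{N}|\mu_j|$ (for $N=\infty$ the limit of the non-increasing partial products, which may be $0$), and let $q\in(p,1)$. Then there exist a holomorphic map $f:\mathbb D\to\mathbb D$ and points $\eta_1,\eta_2,\dots\in\mathbb D$ such that $\prod_{j=1}^{N}|\eta_j|=q$, $f(0)=0$, and $f(\eta_j)=\mu_j$ for every $j\ge 1$. (For finite $N$ this contains the statement for a finite family $\mu_1,\dots,\mu_N$, which may be extended arbitrarily to a sequence in $\mathbb D$.) -/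

import Mathlib

/-- The open unit disc in the complex plane. -/
abbrev unitDisc : Set ℂ := Metric.ball (0 : ℂ) 1

/-- `f` restricts to a holomorphic map of the open unit disc into itself. -/
def IsHolomorphicSelfMap (f : ℂ → ℂ) : Prop :=
  DifferentiableOn ℂ f unitDisc ∧ Set.MapsTo f unitDisc unitDisc

/-!
Lifting values through self-maps of the disc fixing `0`, and composing three such maps, reduces
everything to a positive convergent product of moduli.

If the product `p` of the moduli `‖v j‖` is positive, a Blaschke product
`z ↦ z (a - z) / (1 - a z)` suffices. Each value `v` has two preimages, with product `v`, and the
larger of their moduli is at least `√‖v‖` and at most `1`, so that the product of the larger moduli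
converges uniformly in `a ∈ [0, 1]`. It is continuous in `a`, equal to `√p` at `a = 0` and to `1` at
`a = 1`, and the product of the smaller moduli is `p` divided by it. By the intermediate value
theorem the two together take every value in `(p, 1)`
(`exists_selfMap_hasProd_norm_eq`).

In general `q > p` only gives a finite set `s` of indices with `∏ j ∈ s, ‖μ j‖ < q`. After a lift
through another such Blaschke product this finite product is also positive
(`exists_selfMap_finset_prod_norm_pos`). A second lift, through the universal covering of the disc
punctured at a point `exp (-t)`, makes the full product converge to a positive number
(`exists_selfMap_hasProd_norm_pos`): its fibres accumulate at the boundary, which handles the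
indices outside `s`, and as `t → 0` it tends to the identity, so that the indices in `s` have lifts
whose product is still below `q`. The first case then applies to the lifted points.
-/

/-! ### Automorphisms of the disc -/

/-- The involutive automorphism of the unit disc exchanging `0` and the real point `a`. -/
noncomputable def discInvolution (a : ℝ) (z : ℂ) : ℂ := (a - z) / (1 - a * z)

theorem mem_unitDisc_iff {z : ℂ} : z ∈ unitDisc ↔ ‖z‖ < 1 := mem_ball_zero_iff

theorem IsHolomorphicSelfMap.comp {f g : ℂ → ℂ} (hf : IsHolomorphicSelfMap f)
    (hg : IsHolomorphicSelfMap g) : IsHolomorphicSelfMap (f ∘ g) :=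
  ⟨hf.1.comp hg.1 hg.2, hf.2.comp hg.2⟩

theorem isHolomorphicSelfMap_id : IsHolomorphicSelfMap id :=
  ⟨differentiableOn_id, Set.mapsTo_id _⟩

theorem norm_one_sub_mul_sq_sub (a : ℝ) (z : ℂ) :
    ‖1 - a * z‖ ^ 2 - ‖a - z‖ ^ 2 = (1 - a ^ 2) * (1 - ‖z‖ ^ 2) := by
  simp only [Complex.sq_norm, Complex.normSq_apply, Complex.sub_re, Complex.sub_im,
    Complex.mul_re, Complex.mul_im, Complex.one_re, Complex.one_im, Complex.ofReal_re,
    Complex.ofReal_im]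
  ring

theorem one_sub_mul_ne_zero {a : ℝ} (ha0 : 0 ≤ a) (ha1 : a < 1) {z : ℂ} (hz : ‖z‖ < 1) :
    (1 : ℂ) - a * z ≠ 0 := by
  intro h
  have h1 : ‖(a : ℂ) * z‖ = 1 := by rw [← sub_eq_zero.mp h, norm_one]
  rw [norm_mul, Complex.norm_real, Real.norm_of_nonneg ha0] at h1
  nlinarith [norm_nonneg z]

theorem norm_discInvolution_lt_one {a : ℝ} (ha0 : 0 ≤ a) (ha1 : a < 1) {z : ℂ} (hz : ‖z‖ < 1) :
    ‖discInvolution a z‖ < 1 := by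
  have h0 := norm_pos_iff.mpr (one_sub_mul_ne_zero ha0 ha1 hz)
  rw [discInvolution, norm_div, div_lt_one h0]
  refine lt_of_pow_lt_pow_left₀ 2 h0.le ?_
  have h1 : 0 < (1 - a ^ 2) * (1 - ‖z‖ ^ 2) :=
    mul_pos (by nlinarith) (by nlinarith [norm_nonneg z])
  linarith [norm_one_sub_mul_sq_sub a z]

theorem isHolomorphicSelfMap_discInvolution {a : ℝ} (ha0 : 0 ≤ a) (ha1 : a < 1) :
    IsHolomorphicSelfMap (discInvolution a) := by
  refine ⟨fun z hz => ?_, fun z hz => ?_⟩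
  · have h := one_sub_mul_ne_zero ha0 ha1 (mem_unitDisc_iff.mp hz)
    unfold discInvolution
    exact DifferentiableAt.differentiableWithinAt (by fun_prop (disch := exact h))
  · exact mem_unitDisc_iff.mpr (norm_discInvolution_lt_one ha0 ha1 (mem_unitDisc_iff.mp hz))

theorem discInvolution_discInvolution {a : ℝ} (ha0 : 0 ≤ a) (ha1 : a < 1) {z : ℂ}
    (hz : ‖z‖ < 1) : discInvolution a (discInvolution a z) = z := by
  have h := one_sub_mul_ne_zero ha0 ha1 hz
  have h' := one_sub_mul_ne_zero ha0 ha1 (norm_discInvolution_lt_one ha0 ha1 hz)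
  unfold discInvolution at h' ⊢
  rw [div_eq_iff h']
  field_simp
  ring

/-! ### Blaschke products of degree two -/

/-- The Blaschke product of degree two with zeros `0` and `a`. -/
noncomputable def blaschkeTwo (a : ℝ) (z : ℂ) : ℂ := z * discInvolution a z

theorem blaschkeTwo_zero (a : ℝ) : blaschkeTwo a 0 = 0 := zero_mul _

theorem isHolomorphicSelfMap_blaschkeTwo {a : ℝ} (ha0 : 0 ≤ a) (ha1 : a < 1) :
    IsHolomorphicSelfMap (blaschkeTwo a) := by
  have hA := isHolomorphicSelfMap_discInvolution ha0 ha1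
  refine ⟨differentiableOn_id.mul hA.1, fun z hz => mem_unitDisc_iff.mpr ?_⟩
  have h1 := mem_unitDisc_iff.mp hz
  have h2 := mem_unitDisc_iff.mp (hA.2 hz)
  rw [blaschkeTwo, norm_mul]
  exact mul_lt_one_of_nonneg_of_lt_one_left (norm_nonneg _) h1 h2.le

/-- Clearing denominators, `blaschkeTwo a z = v` is the equation `z ^ 2 - a (1 + v) z + v = 0`.
Both of its roots lie in the disc, because `blaschkeTwo a` has modulus at least `1` outside. -/
theorem blaschkeTwo_eq_of_root {a : ℝ} (ha0 : 0 ≤ a) (ha1 : a < 1) {v z w : ℂ} (hv : ‖v‖ < 1)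
    (hadd : z + w = a * (1 + v)) (hmul : z * w = v) : ‖z‖ < 1 ∧ blaschkeTwo a z = v := by
  have heq : z * (a - z) = v * (1 - a * z) := by linear_combination hmul - z * hadd
  have haC : (a : ℂ) ^ 2 ≠ 1 := by
    norm_cast
    nlinarith
  have hne : (1 : ℂ) - a * z ≠ 0 := by
    intro h
    rw [h, mul_zero] at heq
    rcases mul_eq_zero.mp heq with h1 | h1
    · rw [h1] at h
      simp at h
    · rw [← sub_eq_zero.mp h1] at h
      exact haC (by linear_combination -h)
  refine ⟨?_, ?_⟩
  · by_contra! hz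
    have h1 : ‖(1 : ℂ) - a * z‖ ≤ ‖(a : ℂ) - z‖ := by
      refine le_of_sq_le_sq ?_ (norm_nonneg _)
      have : 0 ≤ (1 - a ^ 2) * (‖z‖ ^ 2 - 1) := mul_nonneg (by nlinarith) (by nlinarith)
      linarith [norm_one_sub_mul_sq_sub a z]
    have h2 := congrArg norm heq
    rw [norm_mul, norm_mul] at h2
    have h3 := norm_pos_iff.mpr hne
    nlinarith [norm_nonneg v, norm_nonneg z]
  · rw [blaschkeTwo, discInvolution, mul_div_assoc', div_eq_iff hne, heq]

/-- The roots of a monic quadratic polynomial, ordered by modulus. -/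
theorem exists_ordered_roots (b v : ℂ) : ∃ z w : ℂ, z + w = b ∧ z * w = v ∧ ‖w‖ ≤ ‖z‖ := by
  obtain ⟨s, hs⟩ := IsAlgClosed.exists_pow_nat_eq (b ^ 2 - 4 * v) two_pos
  rcases le_total ‖(b - s) / 2‖ ‖(b + s) / 2‖ with h | h
  · exact ⟨_, _, by ring, by linear_combination -hs / 4, h⟩
  · exact ⟨_, _, by ring, by linear_combination -hs / 4, h⟩

/-- The larger modulus of the two roots of `X ^ 2 - b X + v`. The formula expresses it through
`‖z‖ + ‖w‖` and `‖z‖ - ‖w‖`, which makes its continuity in `b` visible. -/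
noncomputable def maxRootNorm (b v : ℂ) : ℝ :=
  (√((‖b‖ ^ 2 + ‖b ^ 2 - 4 * v‖) / 2 + 2 * ‖v‖) +
    √((‖b‖ ^ 2 + ‖b ^ 2 - 4 * v‖) / 2 - 2 * ‖v‖)) / 2

theorem continuous_maxRootNorm (v : ℂ) : Continuous fun b => maxRootNorm b v := by
  unfold maxRootNorm
  fun_prop

theorem norm_eq_maxRootNorm {b v z w : ℂ} (hadd : z + w = b) (hmul : z * w = v)
    (hle : ‖w‖ ≤ ‖z‖) : ‖z‖ = maxRootNorm b v := by
  have h1 : b ^ 2 - 4 * v = (z - w) ^ 2 := by rw [← hadd, ← hmul]; ring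
  have h2 := parallelogram_law_with_norm ℝ z w
  have h3 : (‖b‖ ^ 2 + ‖b ^ 2 - 4 * v‖) / 2 = ‖z‖ ^ 2 + ‖w‖ ^ 2 := by
    rw [h1, norm_pow, ← hadd]
    linarith
  have h4 : ‖v‖ = ‖z‖ * ‖w‖ := by rw [← hmul, norm_mul]
  rw [maxRootNorm, h3, h4,
    show ‖z‖ ^ 2 + ‖w‖ ^ 2 + 2 * (‖z‖ * ‖w‖) = (‖z‖ + ‖w‖) ^ 2 by ring,
    show ‖z‖ ^ 2 + ‖w‖ ^ 2 - 2 * (‖z‖ * ‖w‖) = (‖z‖ - ‖w‖) ^ 2 by ring,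
    Real.sqrt_sq (by positivity), Real.sqrt_sq (by linarith)]
  ring

theorem norm_le_maxRootNorm_sq (b v : ℂ) : ‖v‖ ≤ maxRootNorm b v ^ 2 := by
  obtain ⟨z, w, hadd, hmul, hle⟩ := exists_ordered_roots b v
  rw [← norm_eq_maxRootNorm hadd hmul hle, ← hmul, norm_mul]
  nlinarith [norm_nonneg z]

theorem maxRootNorm_nonneg (b v : ℂ) : 0 ≤ maxRootNorm b v := by
  unfold maxRootNorm
  positivity

theorem maxRootNorm_pos (b : ℂ) {v : ℂ} (hv : v ≠ 0) : 0 < maxRootNorm b v := by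
  have h1 := norm_le_maxRootNorm_sq b v
  have h2 := norm_pos_iff.mpr hv
  rcases (maxRootNorm_nonneg b v).eq_or_lt with h | h
  · rw [← h] at h1
    norm_num at h1
    exact absurd h1 hv
  · exact h

theorem maxRootNorm_zero (v : ℂ) : maxRootNorm 0 v ^ 2 = ‖v‖ := by
  obtain ⟨z, w, hadd, hmul, hle⟩ := exists_ordered_roots 0 v
  rw [← norm_eq_maxRootNorm hadd hmul hle, ← hmul, eq_neg_of_add_eq_zero_right hadd, norm_mul,
    norm_neg, sq]

theorem maxRootNorm_one_add {v : ℂ} (hv : ‖v‖ ≤ 1) : maxRootNorm (1 + v) v = 1 := by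
  rw [← norm_eq_maxRootNorm rfl (one_mul v) (by simpa using hv), norm_one]

theorem maxRootNorm_le_one {a : ℝ} (ha0 : 0 ≤ a) (ha1 : a ≤ 1) {v : ℂ} (hv : ‖v‖ < 1) :
    maxRootNorm (a * (1 + v)) v ≤ 1 := by
  rcases ha1.eq_or_lt with rfl | ha1
  · rw [Complex.ofReal_one, one_mul, maxRootNorm_one_add hv.le]
  · obtain ⟨z, w, hadd, hmul, hle⟩ := exists_ordered_roots (a * (1 + v)) v
    rw [← norm_eq_maxRootNorm hadd hmul hle]
    exact (blaschkeTwo_eq_of_root ha0 ha1 hv hadd hmul).1.le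

theorem abs_log_maxRootNorm_le {a : ℝ} (ha0 : 0 ≤ a) (ha1 : a ≤ 1) {v : ℂ} (hv0 : v ≠ 0)
    (hv : ‖v‖ < 1) : |Real.log (maxRootNorm (a * (1 + v)) v)| ≤ -Real.log ‖v‖ := by
  have h0 := maxRootNorm_pos (a * (1 + v)) hv0
  have h1 := maxRootNorm_le_one ha0 ha1 hv
  have hv' := norm_pos_iff.mpr hv0
  rw [abs_of_nonpos (Real.log_nonpos h0.le h1), neg_le_neg_iff]
  exact Real.log_le_log hv' ((norm_le_maxRootNorm_sq _ v).trans (by nlinarith))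

/-! ### Prescribing a positive product of moduli -/

theorem HasProd.hasSum_log {ι : Type*} {x : ι → ℝ} {p : ℝ} (h : HasProd x p) (hp : p ≠ 0)
    (hx : ∀ i, x i ≠ 0) : HasSum (fun i => Real.log (x i)) (Real.log p) := by
  refine ((Real.continuousAt_log hp).tendsto.comp h).congr fun s => ?_
  simp [Real.log_prod fun i _ => hx i]

theorem hasProd_of_hasSum_log {ι : Type*} {x : ι → ℝ} {p : ℝ} (hp : 0 < p) (hx : ∀ i, 0 < x i)
    (h : HasSum (fun i => Real.log (x i)) (Real.log p)) : HasProd x p := by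
  have := h.rexp
  rw [Real.exp_log hp] at this
  exact this.congr_fun fun i => (Real.exp_log (hx i)).symm

/-- The case of a convergent product of moduli. The product of the larger moduli of the two
preimages under `blaschkeTwo a` moves continuously from `√p` to `1` as `a` runs through `[0, 1]`,
while the product of the smaller ones is `p` divided by it. -/
theorem exists_selfMap_hasProd_norm_eq {ι : Type*} (S : Set ι) {v : ι → ℂ}
    (hv : ∀ j, v j ∈ unitDisc) {p q : ℝ} (hp0 : 0 < p) (hv0 : ∀ j ∈ S, v j ≠ 0)
    (hp : HasProd (fun j : S => ‖v j‖) p) (hpq : p < q) (hq : q < 1) :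
    ∃ (f : ℂ → ℂ) (η : ι → ℂ), IsHolomorphicSelfMap f ∧ (∀ j, η j ∈ unitDisc) ∧
      HasProd (fun j : S => ‖η j‖) q ∧ f 0 = 0 ∧ ∀ j, f (η j) = v j := by
  have hq0 := hp0.trans hpq
  have hv1 : ∀ j, ‖v j‖ < 1 := fun j => mem_unitDisc_iff.mp (hv j)
  have hlogp : HasSum (fun j : S => Real.log ‖v j‖) (Real.log p) :=
    hp.hasSum_log hp0.ne' fun j => norm_ne_zero_iff.mpr (hv0 j j.2)
  set M : ℝ → S → ℝ := fun a j => maxRootNorm (a * (1 + v j)) (v j) with hM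
  have hMpos : ∀ a j, 0 < M a j := fun a j => maxRootNorm_pos _ (hv0 j j.2)
  have hbound : ∀ j : S, ∀ a ∈ Set.Icc (0 : ℝ) 1, ‖Real.log (M a j)‖ ≤ -Real.log ‖v j‖ :=
    fun j a ha => abs_log_maxRootNorm_le ha.1 ha.2 (hv0 j j.2) (hv1 j)
  have hsum : ∀ a ∈ Set.Icc (0 : ℝ) 1, Summable fun j => Real.log (M a j) := fun a ha =>
    .of_norm_bounded hlogp.summable.neg fun j => hbound j a ha
  have hcont : ContinuousOn (fun a => ∑' j, Real.log (M a j)) (Set.Icc 0 1) := by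
    refine continuousOn_tsum (fun j => Continuous.continuousOn ?_) hlogp.summable.neg hbound
    exact ((continuous_maxRootNorm (v j)).comp (by fun_prop)).log fun a => (hMpos a j).ne'
  have hzero : ∑' j, Real.log (M 0 j) = Real.log p / 2 := by
    rw [← (hlogp.div_const 2).tsum_eq]
    refine tsum_congr fun j => ?_
    have : M 0 j ^ 2 = ‖v j‖ := by simp [hM, maxRootNorm_zero]
    rw [← this, Real.log_pow]
    simp
  have hone : ∑' j, Real.log (M 1 j) = 0 := by
    simp [hM, maxRootNorm_one_add (hv1 _).le]
  have hivt : ∀ y, Real.log p / 2 ≤ y → y < 0 →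
      ∃ a, 0 ≤ a ∧ a < 1 ∧ HasSum (fun j => Real.log (M a j)) y := by
    intro y hy hy0
    obtain ⟨a, ha, hay⟩ := intermediate_value_Icc zero_le_one hcont
      (show y ∈ Set.Icc _ _ by rw [hzero, hone]; exact ⟨hy, hy0.le⟩)
    refine ⟨a, ha.1, lt_of_le_of_ne ha.2 ?_, hay ▸ (hsum a ha).hasSum⟩
    rintro rfl
    exact hy0.ne (hay.symm.trans hone)
  have hlogq : Real.log q < 0 := Real.log_neg hq0 hq
  have hlogpq : Real.log p < Real.log q := Real.log_lt_log hp0 hpq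
  rcases le_total (Real.log p / 2) (Real.log q) with h | h
  · obtain ⟨a, ha0, ha1, ha⟩ := hivt _ h hlogq
    choose z w hadd hmul hle using fun j => exists_ordered_roots (a * (1 + v j)) (v j)
    have hz := fun j => blaschkeTwo_eq_of_root ha0 ha1 (hv1 j) (hadd j) (hmul j)
    refine ⟨blaschkeTwo a, z, isHolomorphicSelfMap_blaschkeTwo ha0 ha1,
      fun j => mem_unitDisc_iff.mpr (hz j).1, ?_, blaschkeTwo_zero a, fun j => (hz j).2⟩
    have hzM : ∀ j : S, ‖z j‖ = M a j := fun j => norm_eq_maxRootNorm (hadd j) (hmul j) (hle j)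
    simp only [hzM]
    exact hasProd_of_hasSum_log hq0 (hMpos a) ha
  · obtain ⟨a, ha0, ha1, ha⟩ := hivt (Real.log p - Real.log q) (by linarith) (by linarith)
    choose z w hadd hmul hle using fun j => exists_ordered_roots (a * (1 + v j)) (v j)
    have hw := fun j => blaschkeTwo_eq_of_root ha0 ha1 (hv1 j)
      ((add_comm _ _).trans (hadd j)) ((mul_comm _ _).trans (hmul j))
    refine ⟨blaschkeTwo a, w, isHolomorphicSelfMap_blaschkeTwo ha0 ha1,
      fun j => mem_unitDisc_iff.mpr (hw j).1, ?_, blaschkeTwo_zero a, fun j => (hw j).2⟩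
    have hzM : ∀ j : S, ‖z j‖ = M a j := fun j => norm_eq_maxRootNorm (hadd j) (hmul j) (hle j)
    have hne : ∀ j : S, z j ≠ 0 ∧ w j ≠ 0 := fun j =>
      mul_ne_zero_iff.mp (by rw [hmul j]; exact hv0 j j.2)
    refine hasProd_of_hasSum_log hq0 (fun j => norm_pos_iff.mpr (hne j).2) ?_
    have h2 := hlogp.sub ha
    rw [sub_sub_cancel] at h2
    refine h2.congr_fun fun j => ?_
    rw [← hzM j, ← hmul j, norm_mul, Real.log_mul (norm_ne_zero_iff.mpr (hne j).1)
      (norm_ne_zero_iff.mpr (hne j).2)]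
    ring

/-! ### Removing zeros among finitely many values -/

/-- Zeros among finitely many of the values can be removed: `0` is replaced by the second zero `a`
of `blaschkeTwo a`, where `a` is so small that the product of the moduli stays below `q`. -/
theorem exists_selfMap_finset_prod_norm_pos {ι : Type*} {S : Set ι} (s : Finset S) {v : ι → ℂ}
    (hv : ∀ j, v j ∈ unitDisc) {q : ℝ} (hq0 : 0 < q) (hq : q < 1) (hs : ∏ j ∈ s, ‖v j‖ < q) :
    ∃ (f : ℂ → ℂ) (η : ι → ℂ), IsHolomorphicSelfMap f ∧ (∀ j, η j ∈ unitDisc) ∧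
      (0 < ∏ j ∈ s, ‖η j‖ ∧ ∏ j ∈ s, ‖η j‖ < q) ∧ f 0 = 0 ∧ ∀ j, f (η j) = v j := by
  by_cases h0 : ∀ j ∈ s, v (j : ι) ≠ 0
  · exact ⟨id, v, isHolomorphicSelfMap_id, hv,
      ⟨Finset.prod_pos fun j hj => norm_pos_iff.mpr (h0 j hj), hs⟩, rfl, fun _ => rfl⟩
  push Not at h0
  obtain ⟨i, his, hi⟩ := h0
  obtain ⟨a, ha0, haq⟩ := exists_between hq0
  have ha1 := haq.trans hq
  have hroot : ∀ j, ∃ z w : ℂ, z + w = a * (1 + v j) ∧ z * w = v j ∧ z ≠ 0 ∧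
      (v j = 0 → z = a) := by
    intro j
    by_cases hj : v j = 0
    · exact ⟨a, 0, by simp [hj], by simp [hj], by exact_mod_cast ha0.ne', fun _ => rfl⟩
    · obtain ⟨z, w, hadd, hmul, -⟩ := exists_ordered_roots (a * (1 + v j)) (v j)
      exact ⟨z, w, hadd, hmul, left_ne_zero_of_mul (hmul ▸ hj), fun h => absurd h hj⟩
  choose z w hadd hmul hne hza using hroot
  have hz := fun j => blaschkeTwo_eq_of_root ha0.le ha1 (mem_unitDisc_iff.mp (hv j))
    (hadd j) (hmul j)
  refine ⟨blaschkeTwo a, z, isHolomorphicSelfMap_blaschkeTwo ha0.le ha1,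
    fun j => mem_unitDisc_iff.mpr (hz j).1,
    ⟨Finset.prod_pos fun j _ => norm_pos_iff.mpr (hne j), ?_⟩, blaschkeTwo_zero a,
    fun j => (hz j).2⟩
  calc ∏ j ∈ s, ‖z j‖ ≤ ∏ j ∈ {i}, ‖z j‖ :=
        Finset.prod_le_prod_of_subset_of_le_one (by simpa using his)
          (fun j _ => norm_nonneg _) fun j _ _ => (hz j).1.le
    _ = a := by rw [Finset.prod_singleton, hza i hi, Complex.norm_real,
          Real.norm_of_nonneg ha0.le]
    _ < q := haq

/-! ### Universal coverings of punctured discs -/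

/-- The Cayley transform, mapping the right half-plane onto the unit disc. Its inverse is
`z ↦ (1 + z) / (1 - z)`. -/
noncomputable def cayley (l : ℂ) : ℂ := (l - 1) / (l + 1)

/-- The universal covering of the disc punctured at `exp (-t)`: the half-plane covers the disc
punctured at `0` through `l ↦ exp (-t l)`, and `discInvolution` moves the puncture. The factor `t`
makes `0` a fixed point. -/
noncomputable def puncturedDiscCover (t : ℝ) (z : ℂ) : ℂ :=
  discInvolution (Real.exp (-t)) (Complex.exp (-(t * ((1 + z) / (1 - z)))))

theorem one_sub_ne_zero {z : ℂ} (hz : ‖z‖ < 1) : (1 : ℂ) - z ≠ 0 := by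
  intro h
  rw [← sub_eq_zero.mp h, norm_one] at hz
  exact hz.ne rfl

theorem re_one_add_div_one_sub_pos {z : ℂ} (hz : ‖z‖ < 1) : 0 < ((1 + z) / (1 - z)).re := by
  have h1 := Complex.normSq_pos.mpr (one_sub_ne_zero hz)
  have h2 : z.re * z.re + z.im * z.im < 1 := by
    rw [← Complex.normSq_apply, ← Complex.sq_norm]
    nlinarith [norm_nonneg z]
  rw [Complex.div_re, ← add_div]
  refine div_pos ?_ h1
  simp
  linarith

theorem norm_exp_neg_mul_lt_one {t : ℝ} (ht : 0 < t) {l : ℂ} :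
    ‖Complex.exp (-(t * l))‖ < 1 ↔ 0 < l.re := by
  rw [Complex.norm_exp, Real.exp_lt_one_iff]
  simp [ht]

theorem isHolomorphicSelfMap_puncturedDiscCover {t : ℝ} (ht : 0 < t) :
    IsHolomorphicSelfMap (puncturedDiscCover t) := by
  refine (isHolomorphicSelfMap_discInvolution (Real.exp_pos _).le
    (Real.exp_lt_one_iff.mpr (neg_neg_of_pos ht))).comp ⟨fun z hz => ?_, fun z hz => ?_⟩
  · have h := one_sub_ne_zero (mem_unitDisc_iff.mp hz)
    exact DifferentiableAt.differentiableWithinAt (by fun_prop (disch := exact h))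
  · exact mem_unitDisc_iff.mpr ((norm_exp_neg_mul_lt_one ht).mpr
      (re_one_add_div_one_sub_pos (mem_unitDisc_iff.mp hz)))

theorem puncturedDiscCover_zero (t : ℝ) : puncturedDiscCover t 0 = 0 := by
  simp [puncturedDiscCover, discInvolution]

theorem norm_cayley_lt_one {l : ℂ} (hl : 0 < l.re) : ‖cayley l‖ < 1 := by
  have h1 : l + 1 ≠ 0 := fun h => by
    have := congrArg Complex.re h
    simp at this
    linarith
  rw [cayley, norm_div, div_lt_one (norm_pos_iff.mpr h1)]
  refine lt_of_pow_lt_pow_left₀ 2 (norm_nonneg _) ?_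
  simp only [Complex.sq_norm, Complex.normSq_apply]
  simp
  linarith

theorem puncturedDiscCover_cayley {t : ℝ} (ht : 0 < t) {w l : ℂ} (hw : ‖w‖ < 1)
    (hl : Complex.exp (-(t * l)) = discInvolution (Real.exp (-t)) w) :
    ‖cayley l‖ < 1 ∧ puncturedDiscCover t (cayley l) = w := by
  have hc0 := (Real.exp_pos (-t)).le
  have hc1 := Real.exp_lt_one_iff.mpr (neg_neg_of_pos ht)
  have hre : 0 < l.re := by
    rw [← norm_exp_neg_mul_lt_one ht, hl]
    exact norm_discInvolution_lt_one hc0 hc1 hw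
  refine ⟨norm_cayley_lt_one hre, ?_⟩
  have h1 : l + 1 ≠ 0 := fun h => by
    have := congrArg Complex.re h
    simp at this
    linarith
  have h2 : (1 + cayley l) / (1 - cayley l) = l := by
    rw [div_eq_iff (one_sub_ne_zero (norm_cayley_lt_one hre)), cayley]
    field_simp
    ring
  rw [puncturedDiscCover, h2, hl, discInvolution_discInvolution hc0 hc1 hw]

theorem discInvolution_ne_zero {a : ℝ} (ha0 : 0 ≤ a) (ha1 : a < 1) {w : ℂ} (hw : ‖w‖ < 1)
    (hne : (a : ℂ) ≠ w) : discInvolution a w ≠ 0 :=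
  div_ne_zero (sub_ne_zero.mpr hne) (one_sub_mul_ne_zero ha0 ha1 hw)

/-- The preimage of `w` under `puncturedDiscCover t` given by the principal branch of the
logarithm. -/
noncomputable def principalPreimage (t : ℝ) (w : ℂ) : ℂ :=
  cayley (-(Complex.log (discInvolution (Real.exp (-t)) w) / t))

theorem exp_neg_mul_neg_log_div {t : ℝ} (ht : 0 < t) {v : ℂ} (hv : v ≠ 0) :
    Complex.exp (-(t * -(Complex.log v / t))) = v := by
  have : (t : ℂ) ≠ 0 := by exact_mod_cast ht.ne'
  rw [mul_neg, neg_neg, mul_div_cancel₀ _ this, Complex.exp_log hv]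

theorem puncturedDiscCover_principalPreimage {t : ℝ} (ht : 0 < t) {w : ℂ} (hw : ‖w‖ < 1)
    (hne : (Real.exp (-t) : ℂ) ≠ w) :
    ‖principalPreimage t w‖ < 1 ∧ puncturedDiscCover t (principalPreimage t w) = w :=
  puncturedDiscCover_cayley ht hw <| exp_neg_mul_neg_log_div ht <|
    discInvolution_ne_zero (Real.exp_pos _).le (Real.exp_lt_one_iff.mpr (neg_neg_of_pos ht)) hw hne

open Filter Topology in
/-- As the puncture tends to the boundary point `1`, the covering tends to the identity: the
logarithm in `principalPreimage` has derivative `-(1 + w) / (1 - w)` at `t = 0`. -/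
theorem tendsto_principalPreimage {w : ℂ} (hw : ‖w‖ < 1) :
    Tendsto (fun t => principalPreimage t w) (𝓝[>] 0) (𝓝 w) := by
  have h1 := one_sub_ne_zero hw
  have hexp : HasDerivAt (fun t : ℝ => ((Real.exp (-t) : ℝ) : ℂ)) (-1) 0 := by
    have := ((hasDerivAt_neg (0 : ℝ)).exp).ofReal_comp
    simpa using this
  have hinv : HasDerivAt (fun t : ℝ => discInvolution (Real.exp (-t)) w)
      (-((1 + w) / (1 - w))) 0 := by
    have := (hexp.sub_const w).div ((hexp.mul_const w).const_sub 1) (by simpa using h1)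
    refine this.congr_deriv ?_
    simp
    field_simp
    ring
  have hzero : discInvolution (Real.exp (-0)) w = 1 := by simp [discInvolution, h1]
  have hlog := (hinv.clog_real (hzero ▸ Complex.one_mem_slitPlane)).tendsto_slope_zero_right
  rw [hzero] at hlog
  have hcay : ContinuousAt cayley ((1 + w) / (1 - w)) := by
    have hre := re_one_add_div_one_sub_pos hw
    have : (1 + w) / (1 - w) + 1 ≠ 0 := fun h => by
      have := congrArg Complex.re h
      simp only [Complex.add_re, Complex.one_re, Complex.zero_re] at this
      linarith
    unfold cayley
    fun_prop (disch := exact this)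
  have hval : cayley ((1 + w) / (1 - w)) = w := by
    unfold cayley
    field_simp
    ring
  have := hcay.tendsto
  rw [hval] at this
  refine this.comp (Tendsto.congr (fun t => ?_) (by simpa using hlog.neg))
  simp [div_eq_inv_mul]

/-- Every fibre over the punctured disc accumulates at the boundary. -/
theorem exists_preimage_near_boundary {t : ℝ} (ht : 0 < t) {w : ℂ} (hw : ‖w‖ < 1)
    (hne : (Real.exp (-t) : ℂ) ≠ w) {r : ℝ} (hr : r < 1) :
    ∃ z : ℂ, ‖z‖ < 1 ∧ r < ‖z‖ ∧ puncturedDiscCover t z = w := by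
  have hv := discInvolution_ne_zero (Real.exp_pos _).le (Real.exp_lt_one_iff.mpr (neg_neg_of_pos ht)) hw hne
  set l : ℂ := -(Complex.log (discInvolution (Real.exp (-t)) w) / t) with hl
  have htC : (t : ℂ) ≠ 0 := by exact_mod_cast ht.ne'
  -- Adding `2πik / t` to `l` stays in the fibre, and moves `cayley l` towards `1`.
  obtain ⟨k, hk⟩ := exists_nat_gt ((2 / (1 - r) + ‖l + 1‖) / (2 * Real.pi / t))
  set d : ℂ := k * (2 * Real.pi * Complex.I) / t with hd
  have hfib : Complex.exp (-(t * (l - d))) = discInvolution (Real.exp (-t)) w := by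
    rw [show -(t * (l - d)) = -(t * l) + k * (2 * Real.pi * Complex.I) by
      rw [hd]; field_simp; ring, Complex.exp_add, Complex.exp_nat_mul_two_pi_mul_I, mul_one]
    exact exp_neg_mul_neg_log_div ht hv
  obtain ⟨h1, h2⟩ := puncturedDiscCover_cayley ht hw hfib
  refine ⟨cayley (l - d), h1, ?_, h2⟩
  have hdn : ‖d‖ = k * (2 * Real.pi / t) := by
    simp [hd, abs_of_pos ht, abs_of_pos Real.pi_pos]
    ring
  rw [div_lt_iff₀ (by positivity), ← hdn] at hk
  have hbig : 2 / (1 - r) < ‖l - d + 1‖ := by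
    have := norm_sub_norm_le d (l + 1)
    rw [norm_sub_rev, show l + 1 - d = l - d + 1 by ring] at this
    linarith
  have hpos : 0 < ‖l - d + 1‖ := lt_trans (div_pos two_pos (by linarith)) hbig
  rw [div_lt_iff₀ (by linarith)] at hbig
  rw [cayley, norm_div, lt_div_iff₀ hpos]
  have := norm_sub_norm_le (l - d + 1) 2
  rw [show l - d + 1 - 2 = l - d - 1 by ring, Complex.norm_ofNat] at this
  linarith

open Filter Topology in
/-- Lifting through `puncturedDiscCover t` for small `t`: the finitely many points indexed by `s`
are lifted to nearby points, all others so close to the boundary that the product of the moduli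
converges to a positive number. The puncture has to avoid countably many points. -/
theorem exists_selfMap_hasProd_norm_pos {S : Set ℕ} (s : Finset S) {v : ℕ → ℂ}
    (hv : ∀ j, v j ∈ unitDisc) {q : ℝ} (hs0 : 0 < ∏ j ∈ s, ‖v j‖) (hsq : ∏ j ∈ s, ‖v j‖ < q) :
    ∃ (f : ℂ → ℂ) (η : ℕ → ℂ) (P : ℝ), IsHolomorphicSelfMap f ∧ (∀ j, η j ∈ unitDisc) ∧
      (∀ j ∈ S, η j ≠ 0) ∧ HasProd (fun j : S => ‖η j‖) P ∧ 0 < P ∧ P < q ∧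
      f 0 = 0 ∧ ∀ j, f (η j) = v j := by
  classical
  have hv1 := fun j => mem_unitDisc_iff.mp (hv j)
  have htend : Tendsto (fun t => ∏ j ∈ s, ‖principalPreimage t (v j)‖) (𝓝[>] 0)
      (𝓝 (∏ j ∈ s, ‖v j‖)) :=
    tendsto_finsetProd _ fun j _ => (tendsto_principalPreimage (hv1 j)).norm
  obtain ⟨δ, hδ, hδsub⟩ := mem_nhdsGT_iff_exists_Ioo_subset.mp
    (htend.eventually (Ioo_mem_nhds hs0 hsq))
  have hcount : {t : ℝ | ((Real.exp (-t) : ℝ) : ℂ) ∈ Set.range v}.Countable :=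
    (Set.countable_range v).preimage_of_injOn fun x _ y _ hxy => by
      simpa using Complex.ofReal_injective hxy
  obtain ⟨t, ⟨ht0, htδ⟩, htv⟩ :=
    (hcount.dense_compl ℝ).inter_open_nonempty _ isOpen_Ioo (Set.nonempty_Ioo.mpr hδ)
  have hne : ∀ j, (Real.exp (-t) : ℂ) ≠ v j := fun j h => htv ⟨j, h.symm⟩
  obtain ⟨hP0, hPq⟩ := hδsub ⟨ht0, htδ⟩
  choose z hz1 hzr hzv using fun j => exists_preimage_near_boundary ht0 (hv1 j) (hne j)
    (Real.exp_lt_one_iff.mpr (neg_neg_of_pos (pow_pos (one_half_pos (α := ℝ)) j)))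
  have hpr := fun j => puncturedDiscCover_principalPreimage ht0 (hv1 j) (hne j)
  set T : Finset ℕ := s.map (Function.Embedding.subtype _) with hT
  set η : ℕ → ℂ := fun j => if j ∈ T then principalPreimage t (v j) else z j with hη
  have hη1 : ∀ j, ‖η j‖ < 1 := fun j => by
    simp only [hη]
    split_ifs
    exacts [(hpr j).1, hz1 j]
  have hηs : ∏ j ∈ s, ‖η j‖ = ∏ j ∈ s, ‖principalPreimage t (v j)‖ :=
    Finset.prod_congr rfl fun j hj =>
      congrArg norm (if_pos (Finset.mem_map_of_mem (Function.Embedding.subtype _) hj))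
  rw [← hηs] at hP0 hPq
  have hη0 : ∀ j, η j ≠ 0 := fun j => by
    by_cases hj : j ∈ T
    · obtain ⟨i, hi, rfl⟩ := Finset.mem_map.mp hj
      exact norm_ne_zero_iff.mp (Finset.prod_ne_zero_iff.mp hP0.ne' i hi)
    · simp only [hη, if_neg hj]
      exact norm_pos_iff.mp ((Real.exp_pos _).trans (hzr j))
  have hsum : Summable fun j => Real.log ‖η j‖ := by
    refine .of_norm_bounded_eventually (g := fun j : ℕ => (1 / 2 : ℝ) ^ j)
      summable_geometric_two ?_
    filter_upwards [T.finite_toSet.compl_mem_cofinite] with j hj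
    have hj' : η j = z j := if_neg hj
    rw [hj', Real.norm_of_nonpos (Real.log_nonpos (norm_nonneg _) (hz1 j).le), neg_le]
    exact (Real.le_log_iff_exp_le ((Real.exp_pos _).trans (hzr j))).mpr (hzr j).le
  have hprod : HasProd (fun j : S => ‖η j‖) (Real.exp (∑' j : S, Real.log ‖η j‖)) := by
    refine hasProd_of_hasSum_log (Real.exp_pos _) (fun j => norm_pos_iff.mpr (hη0 j)) ?_
    rw [Real.log_exp]
    exact (hsum.subtype S).hasSum
  refine ⟨puncturedDiscCover t, η, _, isHolomorphicSelfMap_puncturedDiscCover ht0,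
    fun j => mem_unitDisc_iff.mpr (hη1 j), fun j _ => hη0 j, hprod, Real.exp_pos _, ?_,
    puncturedDiscCover_zero t, fun j => ?_⟩
  · exact ((Finset.prod_anti_set_of_le_one (fun _ => norm_nonneg _)
      fun j : S => (hη1 j).le).le_of_tendsto hprod s).trans_lt hPq
  · simp only [hη]
    split_ifs
    exacts [(hpr j).2, hzv j]

/-! ### Combining the three maps -/

/-- A product of factors in `[0, 1]` always converges, to the infimum of its finite partial
products; in particular `∏'` takes no junk value here. -/
theorem exists_finset_prod_lt_of_tprod_lt {ι : Type*} {x : ι → ℝ} (hx0 : ∀ i, 0 ≤ x i)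
    (hx1 : ∀ i, x i ≤ 1) {q : ℝ} (hq : ∏' i, x i < q) : ∃ s : Finset ι, ∏ i ∈ s, x i < q := by
  have hbdd : BddBelow (Set.range fun s : Finset ι => ∏ i ∈ s, x i) :=
    ⟨0, Set.forall_mem_range.mpr fun s => Finset.prod_nonneg fun i _ => hx0 i⟩
  have hprod : HasProd x (⨅ s : Finset ι, ∏ i ∈ s, x i) :=
    tendsto_atTop_ciInf (Finset.prod_anti_set_of_le_one hx0 hx1) hbdd
  rw [hprod.tprod_eq] at hq
  exact exists_lt_of_ciInf_lt hq

theorem lemma4 (N : ℕ∞) (hN : 1 ≤ N) (μ : ℕ → ℂ) (hμ : ∀ j, μ j ∈ unitDisc)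
    (p q : ℝ) (hp : p = ∏' j : {j : ℕ // (j : ℕ∞) < N}, ‖μ j‖) (hq : q ∈ Set.Ioo p 1) :
    ∃ (f : ℂ → ℂ) (η : ℕ → ℂ),
      IsHolomorphicSelfMap f ∧
      (∀ j, η j ∈ unitDisc) ∧
      HasProd (fun j : {j : ℕ // (j : ℕ∞) < N} => ‖η j‖) q ∧
      f 0 = 0 ∧
      ∀ j, f (η j) = μ j := by
  obtain ⟨hpq, hq1⟩ := hq
  obtain ⟨s, hs⟩ := exists_finset_prod_lt_of_tprod_lt (fun _ => norm_nonneg _)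
    (fun j : {j : ℕ | (j : ℕ∞) < N} => (mem_unitDisc_iff.mp (hμ j)).le) (hp ▸ hpq)
  have hq0 : 0 < q := (Finset.prod_nonneg fun _ _ => norm_nonneg _).trans_lt hs
  obtain ⟨f, u, hf, hu, ⟨hu0, huq⟩, hf0, hfu⟩ :=
    exists_selfMap_finset_prod_norm_pos s hμ hq0 hq1 hs
  obtain ⟨g, v, P, hg, hv, hv0, hP, hP0, hPq, hg0, hgv⟩ :=
    exists_selfMap_hasProd_norm_pos s hu hu0 huq
  obtain ⟨h, η, hh, hη, hηq, hh0, hhη⟩ :=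
    exists_selfMap_hasProd_norm_eq _ hv hP0 hv0 hP hPq hq1
  refine ⟨f ∘ g ∘ h, η, hf.comp (hg.comp hh), hη, hηq, ?_, fun j => ?_⟩
  · simp [hh0, hg0, hf0]
  · simp [hhη, hgv, hfu]
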